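/- Let $d\ge 1$ and let $(\omega_n)_{n\in\mathbb Z^d}$ be independent, identically distributed real random variables on a probability space $(\Omega,\mathcal A,\mathbb P)$, with an arbitrary common distribution. On $\ell^2(\mathbb Z^d)$ let $h_\omega$ be the self-adjoint operator $$(h_\omega u)(n) = -\sum_{k\in\mathbb Z^d,\ |k|=1} u(n+k) + \omega_n u(n),\qquad D(h_\omega)=\Big\{u\in\ell^2(\mathbb Z^d):\ \sum_n|\omega_n u(n)|^2<\infty\Big\},$$ where $|k|=|k_1|+\dots+|k_d|$. Let $(e_j)_{j\in\mathbb Z^d}$ be the canonical orthonormal basis of $\ell^2(\mathbb Z^d)$, and let $I\subset\mathbb R$ be an open interval. Suppose that dynamical localization holds in $I$, i.e. there are constants $C<\infty$ and $m>0$ such that $$\mathbb E\Big(\sup_{t\in\mathbb R}\big|\langle e_j, e^{-ith_\omega}\chi_I(h_\omega)e_k\rangle\big|\Big)\le C e^{-m|j-k|}\qquad\text{for all } j,k\in\mathbb Z^d,$$ where $e^{-ith_\omega}$ and the spectral projection $\chi_I(h_\omega)$ are defined by the functional calculus for self-adjoint operators. Then, for $\mathbb P$-almost every $\omega$, $h_\omega$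 has pure point spectrum in $I$, i.e. $P_{\rm cont}(h_\omega)\,\chi_I(h_\omega)=0$, where $P_{\rm cont}(h_\omega)$ is the orthogonal projection onto the continuous spectral subspace of $h_\omega$ (the orthogonal complement of the closed span of its eigenvectors). -/

import Mathlib

open MeasureTheory ProbabilityTheory Filter Topology
open scoped ENNReal InnerProductSpace

noncomputable section

namespace Anderson

/-! ### Spectral measures and the Borel functional calculus of a self-adjoint operator -/

section SpectralMeasure

variable {H : Type*} [NormedAddCommGroup H] [InnerProductSpace ℂ H] [CompleteSpace H]

/-- A projection-valued measure on the Borel sets of `ℝ`: orthogonal projections `E B`, strongly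
countably additive, with `E ℝ = 1` and `E (A ∩ B) = E A * E B`.
Values on non-measurable sets are irrelevant. -/
structure ProjValuedMeasure (H : Type*) [NormedAddCommGroup H] [InnerProductSpace ℂ H]
    [CompleteSpace H] where
  proj : Set ℝ → (H →L[ℂ] H)
  isStarProjection : ∀ B, MeasurableSet B → IsStarProjection (proj B)
  proj_univ : proj Set.univ = 1
  proj_inter : ∀ A B, MeasurableSet A → MeasurableSet B → proj (A ∩ B) = proj A * proj B
  hasSum_iUnion : ∀ f : ℕ → Set ℝ, (∀ i, MeasurableSet (f i)) →
    Pairwise (Function.onFun Disjoint f) → ∀ ψ : H,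
      HasSum (fun i => proj (f i) ψ) (proj (⋃ i, f i) ψ)

namespace ProjValuedMeasure

variable (E : ProjValuedMeasure H)

theorem inner_proj {B : Set ℝ} (hB : MeasurableSet B) (φ ψ : H) :
    ⟪φ, E.proj B ψ⟫_ℂ = ⟪E.proj B φ, E.proj B ψ⟫_ℂ := by
  have h := E.isStarProjection B hB
  have h1 : E.proj B ψ = E.proj B (E.proj B ψ) := by
    conv_lhs => rw [← h.isIdempotentElem.eq]
    rfl
  have h2 : ContinuousLinearMap.adjoint (E.proj B) = E.proj B := h.isSelfAdjoint
  conv_lhs => rw [h1]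
  rw [← ContinuousLinearMap.adjoint_inner_left, h2]

theorem inner_proj_self {B : Set ℝ} (hB : MeasurableSet B) (ψ : H) :
    ⟪ψ, E.proj B ψ⟫_ℂ = ((‖E.proj B ψ‖ ^ 2 : ℝ) : ℂ) := by
  rw [E.inner_proj hB, inner_self_eq_norm_sq_to_K]
  norm_cast

theorem proj_empty : E.proj ∅ = 0 := by
  ext ψ
  have h := (E.hasSum_iUnion (fun _ => ∅) (fun _ => MeasurableSet.empty)
    (fun _ _ _ => by simp [Function.onFun]) ψ).summable
  simpa using (summable_const_iff _).1 h

theorem hasSum_norm_sq (f : ℕ → Set ℝ) (hf : ∀ i, MeasurableSet (f i))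
    (hd : Pairwise (Function.onFun Disjoint f)) (ψ : H) :
    HasSum (fun i => ‖E.proj (f i) ψ‖ ^ 2) (‖E.proj (⋃ i, f i) ψ‖ ^ 2) := by
  have h := (E.hasSum_iUnion f hf hd ψ).mapL (innerSL ℂ ψ)
  simp only [innerSL_apply_apply] at h
  rw [E.inner_proj_self (MeasurableSet.iUnion hf)] at h
  simp only [fun i => E.inner_proj_self (hf i) ψ] at h
  exact_mod_cast h

/-- The scalar spectral measure `B ↦ ⟨ψ, E B ψ⟩ = ‖E B ψ‖²` of a vector `ψ`. -/
def measure (ψ : H) : Measure ℝ :=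
  Measure.ofMeasurable (fun B _ => ENNReal.ofReal (‖E.proj B ψ‖ ^ 2))
    (by simp [E.proj_empty])
    (by
      intro f hf hd
      have h := E.hasSum_norm_sq f hf hd ψ
      rw [← h.tsum_eq, ENNReal.ofReal_tsum_of_nonneg (fun _ => by positivity) h.summable])

theorem measure_apply (ψ : H) {B : Set ℝ} (hB : MeasurableSet B) :
    E.measure ψ B = ENNReal.ofReal (‖E.proj B ψ‖ ^ 2) :=
  Measure.ofMeasurable_apply B hB

theorem measure_real_apply (ψ : H) {B : Set ℝ} (hB : MeasurableSet B) :
    (E.measure ψ).real B = ‖E.proj B ψ‖ ^ 2 := by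
  rw [Measure.real, E.measure_apply ψ hB, ENNReal.toReal_ofReal (by positivity)]

instance (ψ : H) : IsFiniteMeasure (E.measure ψ) :=
  ⟨by rw [E.measure_apply ψ MeasurableSet.univ]; exact ENNReal.ofReal_lt_top⟩

/-- The integral of a complex simple function against a projection-valued measure. -/
def simpleOp (s : SimpleFunc ℝ ℂ) : H →L[ℂ] H :=
  ∑ c ∈ s.range, c • E.proj (s ⁻¹' {c})

theorem simpleOp_sub (s t : SimpleFunc ℝ ℂ) :
    E.simpleOp (s - t) = E.simpleOp s - E.simpleOp t := by
  let T : Set ℝ → (ℂ →L[ℝ] (H →L[ℂ] H)) := fun B =>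
    (ContinuousLinearMap.id ℝ ℂ).smulRight (E.proj B)
  have hT : ∀ u : SimpleFunc ℝ ℂ, E.simpleOp u = SimpleFunc.setToSimpleFunc T u := fun u => rfl
  have hadd : FinMeasAdditive (0 : Measure ℝ) T := by
    intro A B hA hB _ _ hAB
    have key : E.proj (A ∪ B) = E.proj A + E.proj B := by
      ext ψ
      let f : ℕ → Set ℝ := fun n => if n = 0 then A else if n = 1 then B else ∅
      have hfm : ∀ i, MeasurableSet (f i) := by
        intro i; simp only [f]; split_ifs <;> simp [hA, hB]
      have hfd : Pairwise (Function.onFun Disjoint f) := by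
        intro i j hij
        simp only [Function.onFun, f]
        split_ifs <;> simp_all [disjoint_comm]
      have hU : (⋃ i, f i) = A ∪ B := by
        ext x
        simp only [Set.mem_iUnion, Set.mem_union, f]
        constructor
        · rintro ⟨i, hi⟩
          split_ifs at hi <;> simp_all
        · rintro (h | h)
          · exact ⟨0, by simpa using h⟩
          · exact ⟨1, by simpa using h⟩
      have h1 := E.hasSum_iUnion f hfm hfd ψ
      rw [hU] at h1
      have h2 : HasSum (fun i => E.proj (f i) ψ) (∑ i ∈ Finset.range 2, E.proj (f i) ψ) := by
        apply hasSum_sum_of_ne_finset_zero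
        intro b hb
        have h0 : b ≠ 0 ∧ b ≠ 1 := by
          simp only [Finset.mem_range, not_lt] at hb
          omega
        simp [f, h0.1, h0.2, E.proj_empty]
      rw [h1.unique h2]
      simp [Finset.sum_range_succ, f]
    ext
    simp [T, key]
  rw [hT, hT, hT]
  exact SimpleFunc.setToSimpleFunc_sub T hadd (by simp) (by simp)

theorem inner_simpleOp (s : SimpleFunc ℝ ℂ) (ψ : H) :
    ⟪ψ, E.simpleOp s ψ⟫_ℂ = ∫ x, s x ∂(E.measure ψ) := by
  rw [← SimpleFunc.integral_eq_integral s s.integrable_of_isFiniteMeasure,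
    SimpleFunc.integral_eq, simpleOp, _root_.sum_apply, inner_sum]
  refine Finset.sum_congr rfl fun c _ => ?_
  rw [_root_.smul_apply, inner_smul_right,
    E.inner_proj_self (s.measurableSet_fiber c), E.measure_real_apply ψ (s.measurableSet_fiber c),
    Complex.real_smul, mul_comm]

theorem norm_sq_simpleOp (s : SimpleFunc ℝ ℂ) (ψ : H) :
    ‖E.simpleOp s ψ‖ ^ 2 = ∫ x, ‖s x‖ ^ 2 ∂(E.measure ψ) := by
  have hint : ∫ x, ‖s x‖ ^ 2 ∂(E.measure ψ)
      = ∑ c ∈ s.range, ‖c‖ ^ 2 * ‖E.proj (s ⁻¹' {c}) ψ‖ ^ 2 := by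
    have h1 : ∀ x, ‖s x‖ ^ 2 = ((s.map fun c : ℂ => ‖c‖ ^ 2) : SimpleFunc ℝ ℝ) x := fun x => rfl
    simp_rw [h1]
    rw [← SimpleFunc.integral_eq_integral _ (SimpleFunc.integrable_of_isFiniteMeasure _),
      SimpleFunc.map_integral s _ s.integrable_of_isFiniteMeasure (by simp)]
    refine Finset.sum_congr rfl fun c _ => ?_
    rw [E.measure_real_apply ψ (s.measurableSet_fiber c), smul_eq_mul, mul_comm]
  have horth : ⟪E.simpleOp s ψ, E.simpleOp s ψ⟫_ℂ
      = ∑ c ∈ s.range, ((‖c‖ ^ 2 * ‖E.proj (s ⁻¹' {c}) ψ‖ ^ 2 : ℝ) : ℂ) := by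
    rw [simpleOp, _root_.sum_apply, sum_inner]
    refine Finset.sum_congr rfl fun c hc => ?_
    rw [inner_sum, Finset.sum_eq_single_of_mem c hc]
    · rw [_root_.smul_apply, inner_self_eq_norm_sq_to_K, norm_smul]
      push_cast
      simp [mul_pow]
    · intro b _ hbc
      have hd : (s ⁻¹' {c}) ∩ (s ⁻¹' {b}) = ∅ := by
        ext x
        simp only [Set.mem_inter_iff, Set.mem_preimage, Set.mem_singleton_iff,
          Set.mem_empty_iff_false, iff_false, not_and]
        rintro h1 h2
        exact hbc (h2.symm.trans h1)
      have h0 := E.proj_inter _ _ (s.measurableSet_fiber c) (s.measurableSet_fiber b)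
      rw [hd, E.proj_empty] at h0
      have hadj : ContinuousLinearMap.adjoint (E.proj (s ⁻¹' {c})) = E.proj (s ⁻¹' {c}) :=
        (E.isStarProjection _ (s.measurableSet_fiber c)).isSelfAdjoint
      have h2 : ⟪E.proj (s ⁻¹' {c}) ψ, E.proj (s ⁻¹' {b}) ψ⟫_ℂ = 0 := by
        rw [← hadj, ContinuousLinearMap.adjoint_inner_left]
        have : E.proj (s ⁻¹' {c}) (E.proj (s ⁻¹' {b}) ψ) = 0 := by
          change (E.proj (s ⁻¹' {c}) * E.proj (s ⁻¹' {b})) ψ = 0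
          rw [← h0]; rfl
        rw [this, inner_zero_right]
      rw [_root_.smul_apply, _root_.smul_apply, inner_smul_left,
        inner_smul_right, h2, mul_zero, mul_zero]
  rw [hint]
  rw [inner_self_eq_norm_sq_to_K] at horth
  apply Complex.ofReal_injective
  push_cast at horth ⊢
  simpa using horth

/-- For bounded Borel `f` there is a bounded operator `A` with `⟨ψ, A ψ⟩ = ∫ f d⟨ψ, E ψ⟩`. -/
theorem exists_integral {f : ℝ → ℂ} (hf : Measurable f) {C : ℝ} (hC : ∀ x, ‖f x‖ ≤ C) :
    ∃ A : H →L[ℂ] H, ∀ ψ : H, ⟪ψ, A ψ⟫_ℂ = ∫ x, f x ∂(E.measure ψ) := by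
  let s : ℕ → SimpleFunc ℝ ℂ := fun n => SimpleFunc.approxOn f hf Set.univ 0 (Set.mem_univ _) n
  have hs : ∀ x, Tendsto (fun n => s n x) atTop (𝓝 (f x)) := fun x =>
    SimpleFunc.tendsto_approxOn hf (Set.mem_univ _) (by simp)
  have hb : ∀ n x, ‖s n x‖ ≤ C + C := fun n x =>
    (SimpleFunc.norm_approxOn_zero_le hf (Set.mem_univ _) x n).trans (add_le_add (hC x) (hC x))
  have hcauchy : ∀ ψ : H, CauchySeq fun n => E.simpleOp (s n) ψ := by
    intro ψ
    have hlim : Tendsto (fun p : ℕ × ℕ => ∫ x, ‖(s p.1 - s p.2) x‖ ^ 2 ∂(E.measure ψ))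
        (atTop ×ˢ atTop) (𝓝 (∫ _, (0 : ℝ) ∂(E.measure ψ))) := by
      refine tendsto_integral_filter_of_dominated_convergence (fun _ => (C + C + (C + C)) ^ 2)
        ?_ ?_ (integrable_const _) ?_
      · exact Eventually.of_forall fun p =>
          ((s p.1 - s p.2).measurable.norm.pow_const 2).aestronglyMeasurable
      · refine Eventually.of_forall fun p => Eventually.of_forall fun x => ?_
        rw [Real.norm_of_nonneg (by positivity)]
        gcongr
        exact (norm_sub_le _ _).trans (add_le_add (hb _ _) (hb _ _))
      · refine Eventually.of_forall fun x => ?_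
        have h1 : Tendsto (fun p : ℕ × ℕ => s p.1 x - s p.2 x) (atTop ×ˢ atTop) (𝓝 (f x - f x)) :=
          ((hs x).comp tendsto_fst).sub ((hs x).comp tendsto_snd)
        simpa using (h1.norm.pow 2)
    rw [integral_zero] at hlim
    rw [cauchySeq_iff_tendsto, uniformity_eq_comap_nhds_zero, tendsto_comap_iff,
      ← prod_atTop_atTop_eq]
    rw [tendsto_zero_iff_norm_tendsto_zero]
    have h2 := hlim.sqrt
    rw [Real.sqrt_zero] at h2
    refine h2.congr fun p => ?_
    rw [← E.norm_sq_simpleOp, Real.sqrt_sq (norm_nonneg _), E.simpleOp_sub]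
    simp [Prod.map, norm_sub_rev]
  choose A hA using fun ψ => cauchySeq_tendsto_of_complete (hcauchy ψ)
  refine ⟨continuousLinearMapOfTendsto (fun n => E.simpleOp (s n)) (f := A) (tendsto_pi_nhds.2 hA),
    fun ψ => ?_⟩
  have h1 : Tendsto (fun n => ⟪ψ, E.simpleOp (s n) ψ⟫_ℂ) atTop (𝓝 ⟪ψ, A ψ⟫_ℂ) :=
    tendsto_const_nhds.inner (hA ψ)
  have h2 : Tendsto (fun n => ∫ x, s n x ∂(E.measure ψ)) atTop
      (𝓝 (∫ x, f x ∂(E.measure ψ))) :=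
    tendsto_integral_of_dominated_convergence (fun _ => C + C)
      (fun n => (s n).measurable.aestronglyMeasurable) (integrable_const _)
      (fun n => Eventually.of_forall fun x => hb n x) (Eventually.of_forall fun x => hs x)
  simp only [E.inner_simpleOp] at h1
  exact tendsto_nhds_unique h1 h2

open Classical in
/-- The operator `∫ f dE` for a bounded Borel function `f`: the unique bounded operator `A` with
`⟨ψ, A ψ⟩ = ∫ f d⟨ψ, E ψ⟩` for all `ψ`. -/
def integral (f : ℝ → ℂ) : H →L[ℂ] H :=
  if h : ∃ A : H →L[ℂ] H, ∀ ψ : H, ⟪ψ, A ψ⟫_ℂ = ∫ x, f x ∂(E.measure ψ) then h.choose else 0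

theorem inner_integral {f : ℝ → ℂ} (hf : Measurable f) {C : ℝ} (hC : ∀ x, ‖f x‖ ≤ C) (ψ : H) :
    ⟪ψ, E.integral f ψ⟫_ℂ = ∫ x, f x ∂(E.measure ψ) := by
  have h := E.exists_integral hf hC
  rw [integral, dif_pos h]
  exact h.choose_spec ψ

end ProjValuedMeasure

/-- `E` is the spectral measure of the (possibly unbounded) operator `T`, i.e. `T = ∫ x dE(x)`:
the domain of `T` is `{ψ | ∫ x² d⟨ψ, E ψ⟩ < ∞}`, and `⟨ψ, T ψ⟩ = ∫ x d⟨ψ, E ψ⟩` on it. By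
polarization the quadratic form determines `T`. By the spectral theorem, each self-adjoint `T`
has exactly one such `E`. -/
structure IsSpectralMeasure (E : ProjValuedMeasure H) (T : H →ₗ.[ℂ] H) : Prop where
  mem_domain_iff : ∀ ψ : H, ψ ∈ T.domain ↔ Integrable (fun x : ℝ => x ^ 2) (E.measure ψ)
  inner_apply : ∀ ψ : T.domain, ⟪(ψ : H), T ψ⟫_ℂ = ((∫ x, x ∂(E.measure (ψ : H)) : ℝ) : ℂ)

open Classical in
/-- The Borel functional calculus: `f(T) = ∫ f dE` for bounded Borel `f` and self-adjoint `T`,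
where `E` is the spectral measure of `T`. (Junk value `0` if `T` has no spectral measure, which
never happens for a self-adjoint `T`.) -/
def borelCalc (T : H →ₗ.[ℂ] H) (f : ℝ → ℂ) : H →L[ℂ] H :=
  if h : ∃ E : ProjValuedMeasure H, IsSpectralMeasure E T then h.choose.integral f else 0

/-- The spectral projection `χ_B(T)`. -/
def spectralProj (T : H →ₗ.[ℂ] H) (B : Set ℝ) : H →L[ℂ] H :=
  borelCalc T (B.indicator fun _ => 1)

/-- The unitary group `e^{-itT}`. -/
def evolution (T : H →ₗ.[ℂ] H) (t : ℝ) : H →L[ℂ] H :=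
  borelCalc T fun x => Complex.exp (-Complex.I * t * x)

/-- The pure point subspace: the closed linear span of all eigenvectors of `T`. -/
def pointSubspace (T : H →ₗ.[ℂ] H) : Submodule ℂ H :=
  (Submodule.span ℂ {ψ : H | ∃ (h : ψ ∈ T.domain) (E : ℂ), T ⟨ψ, h⟩ = E • ψ}).topologicalClosure

/-- `P_cont(T)`: the orthogonal projection onto the continuous spectral subspace of `T`, the
orthogonal complement of the pure point subspace. -/
def contProj (T : H →ₗ.[ℂ] H) : H →L[ℂ] H :=
  (pointSubspace T)ᗮ.starProjection

/-- `T` has pure point spectrum in `I`, i.e. no continuous spectrum there: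
`P_cont(T) χ_I(T) = 0`. -/
def HasPurePointSpectrumIn (T : H →ₗ.[ℂ] H) (I : Set ℝ) : Prop :=
  contProj T ∘L spectralProj T I = 0

end SpectralMeasure

/-! ### The Anderson model on `ℤ^d` -/

/-- The lattice `ℤ^d`. -/
abbrev Lattice (d : ℕ) : Type := Fin d → ℤ

/-- The graph distance to the origin, `|k| = |k_1| + … + |k_d|`. -/
def graphNorm {d : ℕ} (k : Lattice d) : ℤ := ∑ i, |k i|

/-- The finite set of all `k ∈ ℤ^d` with `|k| = 1`; see `mem_unitVectors`. -/
def unitVectors (d : ℕ) : Finset (Lattice d) :=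
  (Fintype.piFinset fun _ => Finset.Icc (-1 : ℤ) 1).filter fun k => graphNorm k = 1

theorem mem_unitVectors {d : ℕ} (k : Lattice d) : k ∈ unitVectors d ↔ graphNorm k = 1 := by
  simp only [unitVectors, Finset.mem_filter, Fintype.mem_piFinset, Finset.mem_Icc,
    and_iff_right_iff_imp]
  intro h i
  have h1 : |k i| ≤ graphNorm k :=
    Finset.single_le_sum (f := fun i => |k i|) (fun _ _ => abs_nonneg _) (Finset.mem_univ i)
  rw [h] at h1
  exact abs_le.1 h1

/-- The Hilbert space `ℓ²(ℤ^d)`. -/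
abbrev L2 (d : ℕ) : Type := lp (fun _ : Lattice d => ℂ) 2

/-- The canonical basis vector `e_j`. -/
def basisVec {d : ℕ} (j : Lattice d) : L2 d := lp.single 2 j 1

/-- `(h_0 u)(n) = -∑_{|k| = 1} u(n + k)`. -/
def laplacian {d : ℕ} (u : Lattice d → ℂ) (n : Lattice d) : ℂ :=
  -∑ k ∈ unitVectors d, u (n + k)

theorem memℓp_laplacian {d : ℕ} {u : Lattice d → ℂ} (hu : Memℓp u 2) :
    Memℓp (laplacian u) 2 := by
  have hshift : ∀ k : Lattice d, Memℓp (fun n => u (n + k)) 2 := by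
    intro k
    rw [memℓp_gen_iff (by norm_num)] at hu ⊢
    exact hu.comp_injective (add_left_injective k)
  have h := (Memℓp.finsetSum (unitVectors d) (fun k _ => hshift k)).neg
  convert h using 1
  ext n
  simp [laplacian]

/-- The operator `h = h_0 + V` on `ℓ²(ℤ^d)` for the potential `v : ℤ^d → ℝ`, with the domain
`{u ∈ ℓ² | ∑ |v_n u(n)|² < ∞}` of the maximal multiplication operator. -/
def hamiltonian {d : ℕ} (v : Lattice d → ℝ) : L2 d →ₗ.[ℂ] L2 d where
  domain :=
    { carrier := {u | Memℓp (fun n => (v n : ℂ) * u n) 2}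
      zero_mem' := by
        simpa using! (zero_memℓp : Memℓp (0 : Lattice d → ℂ) 2)
      add_mem' := by
        intro a b ha hb
        have h := Memℓp.add ha hb
        have e : (fun n => (v n : ℂ) * (a + b : L2 d) n)
            = (fun n => (v n : ℂ) * a n) + fun n => (v n : ℂ) * b n := by
          ext n
          simp [mul_add]
        exact (show Memℓp (fun n => (v n : ℂ) * (a + b : L2 d) n) 2 from e ▸ h)
      smul_mem' := by
        intro c a ha
        have h := Memℓp.const_smul ha c
        have e : (fun n => (v n : ℂ) * (c • a : L2 d) n) = c • fun n => (v n : ℂ) * a n := by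
          ext n
          simp [mul_left_comm]
        exact (show Memℓp (fun n => (v n : ℂ) * (c • a : L2 d) n) 2 from e ▸ h) }
  toFun :=
    { toFun := fun u => ⟨fun n => laplacian (u : L2 d) n + (v n : ℂ) * (u : L2 d) n,
        (memℓp_laplacian (lp.memℓp (u : L2 d))).add u.2⟩
      map_add' := by
        intro a b
        ext n
        rw [lp.coeFn_add, Pi.add_apply]
        simp [laplacian, Finset.sum_add_distrib, mul_add]
        ring
      map_smul' := by
        intro c a
        ext n
        simp [laplacian, Finset.mul_sum, mul_add, mul_left_comm] }

/-- The coordinates `V n` are independent random variables with common distribution `μ`. -/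
structure IsIIDPotential {Ω : Type*} [MeasurableSpace Ω] {d : ℕ} (P : Measure Ω)
    (μ : Measure ℝ) (V : Lattice d → Ω → ℝ) : Prop where
  measurable : ∀ n, Measurable (V n)
  map_eq : ∀ n, P.map (V n) = μ
  indep : iIndepFun V P

/-- Dynamical localization of `h_ω = h_0 + V_ω` in `I`: for some `C < ∞` and `m > 0`,
`𝔼 (sup_t |⟨e_j, e^{-it h_ω} χ_I(h_ω) e_k⟩|) ≤ C e^{-m |j - k|}` for all `j, k`. The expectation
is that of an integrable random variable (the supremum is always at most `1`). -/
def DynamicallyLocalized {Ω : Type*} [MeasurableSpace Ω] {d : ℕ} (P : Measure Ω)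
    (V : Lattice d → Ω → ℝ) (I : Set ℝ) : Prop :=
  ∃ C m : ℝ, 0 < m ∧ ∀ j k : Lattice d,
    let X : Ω → ℝ := fun ω => ⨆ t : ℝ,
      ‖⟪basisVec j, evolution (hamiltonian fun n => V n ω) t
        (spectralProj (hamiltonian fun n => V n ω) I (basisVec k))⟫_ℂ‖
    Integrable X P ∧ ∫ ω, X ω ∂P ≤ C * Real.exp (-m * graphNorm (j - k))

end Anderson

end

/-!
The expectations of `X_j = sup_t |⟨e_j, e^{-ith} χ_I(h) e_k⟩|` are summable over `j`, so almost
surely `∑_j X_j < ∞` and the orbit of `ψ = χ_I(h) e_k` under `e^{-ith}` lies in a Hilbert cube; in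
particular it is totally bounded. Let `χ` be the component of `ψ` off the countably many atoms of
its spectral measure. Its orbit is totally bounded too, but by Wiener's lemma the correlations
`|⟨e^{-imh} χ, e^{-inh} χ⟩|²` tend to `0` in the Cesàro mean over `n`, whereas a finite
`‖χ‖ / 2`-net of the orbit forces the sum of finitely many of them to be at least `‖χ‖⁴ / 4` for
all `n`. Hence `χ = 0`, so `ψ` is a countable sum of eigenvectors.
-/

noncomputable section

namespace Anderson

/-! ### Wiener's lemma -/

/-- The character `x ↦ e^{-itx}` of the real line; `evolution T t` is `borelCalc T (phase t)`. -/
def phase (t x : ℝ) : ℂ := Complex.exp (-Complex.I * t * x)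

theorem continuous_phase (t : ℝ) : Continuous (phase t) := by
  unfold phase
  fun_prop

theorem norm_phase (t x : ℝ) : ‖phase t x‖ = 1 := by
  rw [phase, show -Complex.I * (t : ℂ) * x = ((-(t * x) : ℝ) : ℂ) * Complex.I by push_cast; ring]
  exact Complex.norm_exp_ofReal_mul_I _

theorem phase_natCast_mul_conj (n : ℕ) (x y : ℝ) :
    phase n x * (starRingEnd ℂ) (phase n y) = phase 1 (x - y) ^ n := by
  simp only [phase, ← Complex.exp_conj, ← Complex.exp_add, ← Complex.exp_nat_mul, map_mul, map_neg,
    Complex.conj_I, Complex.conj_ofReal]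
  push_cast
  ring_nf

theorem countable_setOf_phase_one_sub_eq_one (x : ℝ) : {y | phase 1 (x - y) = 1}.Countable := by
  refine (Set.countable_range fun k : ℤ => x + k * (2 * Real.pi)).mono fun y hy => ?_
  obtain ⟨k, hk⟩ := Complex.exp_eq_one_iff.1 hy
  have hmul : ((x + k * (2 * Real.pi) : ℝ) : ℂ) * Complex.I = (y : ℂ) * Complex.I := by
    push_cast at hk ⊢
    linear_combination -hk
  exact ⟨k, Complex.ofReal_injective (mul_right_cancel₀ Complex.I_ne_zero hmul)⟩

theorem norm_cesaro_pow_le_one {𝕜 : Type*} [RCLike 𝕜] {q : 𝕜} (hq : ‖q‖ ≤ 1) (N : ℕ) :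
    ‖(N : 𝕜)⁻¹ * ∑ n ∈ Finset.range N, q ^ n‖ ≤ 1 := by
  have hsum : ‖∑ n ∈ Finset.range N, q ^ n‖ ≤ N := by
    simpa using norm_sum_le_of_le (Finset.range N) fun n _ =>
      (norm_pow q n).trans_le (pow_le_one₀ (norm_nonneg q) hq)
  calc ‖(N : 𝕜)⁻¹ * ∑ n ∈ Finset.range N, q ^ n‖
      = (N : ℝ)⁻¹ * ‖∑ n ∈ Finset.range N, q ^ n‖ := by
        rw [norm_mul, norm_inv, RCLike.norm_natCast]
    _ ≤ (N : ℝ)⁻¹ * N := by gcongr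
    _ ≤ 1 := inv_mul_le_one

theorem tendsto_cesaro_pow_zero {𝕜 : Type*} [RCLike 𝕜] {q : 𝕜} (hq : ‖q‖ ≤ 1) (hq1 : q ≠ 1) :
    Tendsto (fun N : ℕ => (N : 𝕜)⁻¹ * ∑ n ∈ Finset.range N, q ^ n) atTop (𝓝 0) := by
  have hlim : Tendsto (fun N : ℕ => (N : ℝ)⁻¹ * (2 / ‖q - 1‖)) atTop (𝓝 0) := by
    simpa using (tendsto_inv_atTop_nhds_zero_nat (𝕜 := ℝ)).mul_const (2 / ‖q - 1‖)
  refine squeeze_zero_norm (fun N => ?_) hlim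
  rw [geom_sum_eq hq1, norm_mul, norm_inv, norm_div, RCLike.norm_natCast]
  gcongr
  calc ‖q ^ N - 1‖ ≤ ‖q ^ N‖ + ‖(1 : 𝕜)‖ := norm_sub_le _ _
    _ ≤ 1 + 1 := by
      rw [norm_pow, norm_one]
      gcongr
      exact pow_le_one₀ (norm_nonneg q) hq
    _ = 2 := one_add_one_eq_two

section Wiener

variable {μ : Measure ℝ}

theorem ae_phase_one_sub_ne_one [SFinite μ] [NullSingletonClass μ] :
    ∀ᵐ p : ℝ × ℝ ∂μ.prod μ, phase 1 (p.1 - p.2) ≠ 1 := by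
  have hmeas : MeasurableSet {p : ℝ × ℝ | phase 1 (p.1 - p.2) ≠ 1} :=
    ((continuous_phase 1).measurable.comp (measurable_fst.sub measurable_snd))
      (measurableSet_singleton 1).compl
  refine (Measure.ae_prod_iff_ae_ae hmeas).2 (Eventually.of_forall fun x => ?_)
  simpa [ae_iff] using (countable_setOf_phase_one_sub_eq_one x).measure_zero μ

theorem norm_sq_integral_phase_mul [SFinite μ] (g : ℝ → ℂ) (n : ℕ) :
    ((‖∫ x, phase n x * g x ∂μ‖ ^ 2 : ℝ) : ℂ) = ∫ p : ℝ × ℝ,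
      phase 1 (p.1 - p.2) ^ n * (g p.1 * (starRingEnd ℂ) (g p.2)) ∂μ.prod μ := by
  have hsq := Complex.mul_conj' (∫ x, phase n x * g x ∂μ)
  rw [← integral_conj, ← integral_prod_mul] at hsq
  rw [Complex.ofReal_pow, ← hsq]
  refine integral_congr_ae (Eventually.of_forall fun p => ?_)
  simp only [map_mul, ← phase_natCast_mul_conj]
  ring

/-- **Wiener's lemma**, for the complex measure `g dμ`. -/
theorem tendsto_cesaro_norm_sq_integral_phase_mul [SFinite μ] [NullSingletonClass μ] {g : ℝ → ℂ}
    (hg : Integrable g μ) :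
    Tendsto (fun N : ℕ => (N : ℝ)⁻¹ * ∑ n ∈ Finset.range N, ‖∫ x, phase n x * g x ∂μ‖ ^ 2)
      atTop (𝓝 0) := by
  set q : ℝ × ℝ → ℂ := fun p => phase 1 (p.1 - p.2) with hq
  set G : ℝ × ℝ → ℂ := fun p => g p.1 * (starRingEnd ℂ) (g p.2) with hG
  have hq_cont : Continuous q := (continuous_phase 1).comp (continuous_fst.sub continuous_snd)
  have hq_norm (p : ℝ × ℝ) : ‖q p‖ ≤ 1 := (norm_phase _ _).le
  have hG_int : Integrable G (μ.prod μ) :=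
    hg.mul_prod ((LinearIsometryEquiv.integrable_comp_iff (RCLike.conjLIE (K := ℂ))).2 hg)
  have hint (n : ℕ) : Integrable (fun p => q p ^ n * G p) (μ.prod μ) :=
    hG_int.bdd_mul (c := 1) (hq_cont.pow n).aestronglyMeasurable
      (Eventually.of_forall fun p =>
        (norm_pow _ n).trans_le (pow_le_one₀ (norm_nonneg _) (hq_norm p)))
  have hlim : Tendsto (fun N : ℕ => ∫ p, ((N : ℂ)⁻¹ * ∑ n ∈ Finset.range N, q p ^ n) * G p
      ∂μ.prod μ) atTop (𝓝 (∫ _, (0 : ℂ) ∂μ.prod μ)) := by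
    refine tendsto_integral_of_dominated_convergence (fun p => ‖G p‖) (fun N => ?_) hG_int.norm
      (fun N => Eventually.of_forall fun p => ?_) ?_
    · exact (Continuous.aestronglyMeasurable (by fun_prop)).mul hG_int.aestronglyMeasurable
    · rw [norm_mul]
      exact mul_le_of_le_one_left (norm_nonneg _) (norm_cesaro_pow_le_one (hq_norm p) N)
    · filter_upwards [ae_phase_one_sub_ne_one (μ := μ)] with p hp
      simpa using (tendsto_cesaro_pow_zero (hq_norm p) hp).mul_const (G p)
  have hswap (N : ℕ) : ∫ p, ((N : ℂ)⁻¹ * ∑ n ∈ Finset.range N, q p ^ n) * G p ∂μ.prod μ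
      = (((N : ℝ)⁻¹ * ∑ n ∈ Finset.range N, ‖∫ x, phase n x * g x ∂μ‖ ^ 2 : ℝ) : ℂ) := by
    simp_rw [mul_assoc, Finset.sum_mul]
    rw [integral_const_mul, integral_finsetSum _ fun n _ => hint n]
    simp only [hq, hG, ← norm_sq_integral_phase_mul]
    push_cast
    rfl
  rw [integral_zero] at hlim
  simp only [hswap] at hlim
  simpa only [Function.comp_def, Complex.ofReal_re, Complex.zero_re] using
    (Complex.continuous_re.tendsto 0).comp hlim

end Wiener

/-! ### The bounded Borel functional calculus is a `*`-homomorphism -/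

/-- The bounded Borel functions `ℝ → ℂ`, i.e. the functions that `ProjValuedMeasure.integral` can
integrate. -/
structure IsBoundedBorel (f : ℝ → ℂ) : Prop where
  measurable : Measurable f
  exists_norm_le : ∃ C : ℝ, ∀ x, ‖f x‖ ≤ C

theorem isBoundedBorel_phase (t : ℝ) : IsBoundedBorel (phase t) :=
  ⟨(continuous_phase t).measurable, 1, fun x => (norm_phase t x).le⟩

theorem isBoundedBorel_const (c : ℂ) : IsBoundedBorel fun _ => c :=
  ⟨measurable_const, ‖c‖, fun _ => le_rfl⟩

theorem isBoundedBorel_simpleFunc (s : SimpleFunc ℝ ℂ) : IsBoundedBorel s :=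
  ⟨s.measurable, s.exists_forall_norm_le⟩

namespace IsBoundedBorel

variable {f g : ℝ → ℂ}

theorem add (hf : IsBoundedBorel f) (hg : IsBoundedBorel g) : IsBoundedBorel (f + g) := by
  obtain ⟨C, hC⟩ := hf.exists_norm_le
  obtain ⟨D, hD⟩ := hg.exists_norm_le
  exact ⟨hf.measurable.add hg.measurable, C + D, fun x => norm_add_le_of_le (hC x) (hD x)⟩

theorem mul (hf : IsBoundedBorel f) (hg : IsBoundedBorel g) : IsBoundedBorel (f * g) := by
  obtain ⟨C, hC⟩ := hf.exists_norm_le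
  obtain ⟨D, hD⟩ := hg.exists_norm_le
  exact ⟨hf.measurable.mul hg.measurable, C * D, fun x => norm_mul_le_of_le (hC x) (hD x)⟩

theorem smul (c : ℂ) (hf : IsBoundedBorel f) : IsBoundedBorel (c • f) := by
  obtain ⟨C, hC⟩ := hf.exists_norm_le
  exact ⟨hf.measurable.const_smul c, ‖c‖ * C, fun x =>
    (norm_smul_le c (f x)).trans (mul_le_mul_of_nonneg_left (hC x) (norm_nonneg c))⟩

theorem star (hf : IsBoundedBorel f) : IsBoundedBorel (star f) :=
  ⟨continuous_star.measurable.comp hf.measurable, by simpa using hf.exists_norm_le⟩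

theorem indicator (hf : IsBoundedBorel f) {B : Set ℝ} (hB : MeasurableSet B) :
    IsBoundedBorel (B.indicator f) := by
  obtain ⟨C, hC⟩ := hf.exists_norm_le
  exact ⟨hf.measurable.indicator hB, C, fun x => (norm_indicator_le_norm_self f x).trans (hC x)⟩

theorem integrable (hf : IsBoundedBorel f) (μ : Measure ℝ) [IsFiniteMeasure μ] :
    Integrable f μ := by
  obtain ⟨C, hC⟩ := hf.exists_norm_le
  exact .of_bound hf.measurable.aestronglyMeasurable C (Eventually.of_forall hC)

theorem exists_simpleFunc_tendsto (hf : IsBoundedBorel f) :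
    ∃ (s : ℕ → SimpleFunc ℝ ℂ) (C : ℝ), (∀ n x, ‖s n x‖ ≤ C) ∧
      ∀ x, Tendsto (fun n => s n x) atTop (𝓝 (f x)) := by
  obtain ⟨C, hC⟩ := hf.exists_norm_le
  exact ⟨fun n => SimpleFunc.approxOn f hf.measurable Set.univ 0 (Set.mem_univ _) n, C + C,
    fun n x => (SimpleFunc.norm_approxOn_zero_le hf.measurable (Set.mem_univ _) x n).trans
      (add_le_add (hC x) (hC x)),
    fun x => SimpleFunc.tendsto_approxOn hf.measurable (Set.mem_univ _) (by simp)⟩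

end IsBoundedBorel

section QuadraticForm

variable {V : Type*} [NormedAddCommGroup V] [InnerProductSpace ℂ V]

theorem eq_of_forall_inner_apply_self {A B : V →L[ℂ] V} (h : ∀ ψ : V, ⟪ψ, A ψ⟫_ℂ = ⟪ψ, B ψ⟫_ℂ) :
    A = B :=
  ContinuousLinearMap.coe_injective <| (ext_inner_map _ _).1 fun ψ => by
    simpa using congrArg (starRingEnd ℂ) (h ψ)

theorem tendsto_inner_apply_of_tendsto_inner_apply_self {ι : Type*} {l : Filter ι}
    {A : ι → V →L[ℂ] V} {B : V →L[ℂ] V}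
    (h : ∀ ψ : V, Tendsto (fun i => ⟪ψ, A i ψ⟫_ℂ) l (𝓝 ⟪ψ, B ψ⟫_ℂ)) (φ ψ : V) :
    Tendsto (fun i => ⟪φ, A i ψ⟫_ℂ) l (𝓝 ⟪φ, B ψ⟫_ℂ) := by
  have hquad (ψ : V) : Tendsto (fun i => ⟪A i ψ, ψ⟫_ℂ) l (𝓝 ⟪B ψ, ψ⟫_ℂ) := by
    simpa using (h ψ).star
  have hpol (C : V →L[ℂ] V) := inner_map_polarization (C : V →ₗ[ℂ] V) φ ψ
  have hflip : Tendsto (fun i => ⟪A i ψ, φ⟫_ℂ) l (𝓝 ⟪B ψ, φ⟫_ℂ) := by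
    simp only [ContinuousLinearMap.coe_coe] at hpol
    simp only [hpol]
    exact ((((hquad _).sub (hquad _)).add ((hquad _).const_mul _)).sub
      ((hquad _).const_mul _)).div_const 4
  simpa using hflip.star

end QuadraticForm


section FunctionalCalculus

variable {H : Type*} [NormedAddCommGroup H] [InnerProductSpace ℂ H] [CompleteSpace H]

namespace ProjValuedMeasure

variable (E : ProjValuedMeasure H) {A B : Set ℝ} {f g : ℝ → ℂ}

theorem proj_proj_apply (hA : MeasurableSet A) (hB : MeasurableSet B) (ψ : H) :
    E.proj A (E.proj B ψ) = E.proj (A ∩ B) ψ := by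
  rw [E.proj_inter A B hA hB, mul_apply_eq_comp]

theorem inner_proj_left (hB : MeasurableSet B) (φ ψ : H) :
    ⟪E.proj B φ, ψ⟫_ℂ = ⟪φ, E.proj B ψ⟫_ℂ :=
  (E.isStarProjection B hB).isSelfAdjoint.isSymmetric φ ψ

theorem measure_proj (hB : MeasurableSet B) (ψ : H) :
    E.measure (E.proj B ψ) = (E.measure ψ).restrict B := by
  ext A hA
  rw [Measure.restrict_apply hA, E.measure_apply _ hA, E.measure_apply _ (hA.inter hB),
    E.proj_proj_apply hA hB]

theorem measure_eq_zero_iff (hB : MeasurableSet B) (ψ : H) :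
    E.measure ψ B = 0 ↔ E.proj B ψ = 0 := by
  rw [E.measure_apply ψ hB, ENNReal.ofReal_eq_zero, ← norm_eq_zero, sq_nonpos_iff]

theorem inner_integral_self (hf : IsBoundedBorel f) (ψ : H) :
    ⟪ψ, E.integral f ψ⟫_ℂ = ∫ x, f x ∂E.measure ψ :=
  E.inner_integral hf.measurable hf.exists_norm_le.choose_spec ψ

theorem eq_integral_of_inner (hf : IsBoundedBorel f) {T : H →L[ℂ] H}
    (hT : ∀ ψ, ⟪ψ, T ψ⟫_ℂ = ∫ x, f x ∂E.measure ψ) : T = E.integral f :=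
  eq_of_forall_inner_apply_self fun ψ => (hT ψ).trans (E.inner_integral_self hf ψ).symm

theorem integral_add (hf : IsBoundedBorel f) (hg : IsBoundedBorel g) :
    E.integral (f + g) = E.integral f + E.integral g := by
  refine (E.eq_integral_of_inner (hf.add hg) fun ψ => ?_).symm
  rw [add_apply, inner_add_right, E.inner_integral_self hf, E.inner_integral_self hg,
    ← MeasureTheory.integral_add (hf.integrable _) (hg.integrable _)]
  rfl

theorem integral_smul (c : ℂ) (hf : IsBoundedBorel f) :
    E.integral (c • f) = c • E.integral f := by
  refine (E.eq_integral_of_inner (hf.smul c) fun ψ => ?_).symm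
  rw [smul_apply, inner_smul_right, E.inner_integral_self hf, ← integral_const_mul]
  rfl

theorem adjoint_integral (hf : IsBoundedBorel f) :
    ContinuousLinearMap.adjoint (E.integral f) = E.integral (star f) := by
  refine E.eq_integral_of_inner hf.star fun ψ => ?_
  rw [ContinuousLinearMap.adjoint_inner_right, ← inner_conj_symm, E.inner_integral_self hf,
    ← integral_conj]
  rfl

theorem integral_indicator_one (hB : MeasurableSet B) :
    E.integral (B.indicator fun _ => 1) = E.proj B := by
  refine (E.eq_integral_of_inner ((isBoundedBorel_const 1).indicator hB) fun ψ => ?_).symm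
  rw [E.inner_proj_self hB, integral_indicator hB, setIntegral_const, E.measure_real_apply ψ hB,
    Complex.real_smul, mul_one]

theorem proj_add_proj_compl (hB : MeasurableSet B) : E.proj B + E.proj Bᶜ = 1 := by
  have hone := isBoundedBorel_const 1
  rw [← E.integral_indicator_one hB, ← E.integral_indicator_one hB.compl,
    ← E.integral_add (hone.indicator hB) (hone.indicator hB.compl), Set.indicator_self_add_compl,
    ← Set.indicator_univ fun _ => (1 : ℂ), E.integral_indicator_one MeasurableSet.univ, E.proj_univ]

theorem proj_mul_integral_mul_proj (hf : IsBoundedBorel f) (hB : MeasurableSet B) :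
    E.proj B * E.integral f * E.proj B = E.integral (B.indicator f) := by
  refine E.eq_integral_of_inner (hf.indicator hB) fun ψ => ?_
  rw [integral_indicator hB, ← E.measure_proj hB, ← E.inner_integral_self hf]
  exact (E.inner_proj_left hB _ _).symm

theorem proj_mul_proj_compl (hB : MeasurableSet B) : E.proj B * E.proj Bᶜ = 0 := by
  rw [← E.proj_inter B Bᶜ hB hB.compl, Set.inter_compl_self, E.proj_empty]

theorem proj_mul_integral (hf : IsBoundedBorel f) (hB : MeasurableSet B) :
    E.proj B * E.integral f = E.integral (B.indicator f) := by
  have hdecomp : E.integral f = E.proj B * E.integral f * E.proj B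
      + E.proj Bᶜ * E.integral f * E.proj Bᶜ := by
    rw [E.proj_mul_integral_mul_proj hf hB, E.proj_mul_integral_mul_proj hf hB.compl,
      ← E.integral_add (hf.indicator hB) (hf.indicator hB.compl), Set.indicator_self_add_compl]
  calc E.proj B * E.integral f
      = E.proj B * E.integral f * E.proj B := by
        conv_lhs => rw [hdecomp]
        simp only [mul_add, ← mul_assoc, (E.isStarProjection B hB).isIdempotentElem.eq,
          E.proj_mul_proj_compl hB, zero_mul, add_zero]
    _ = E.integral (B.indicator f) := E.proj_mul_integral_mul_proj hf hB

theorem tendsto_inner_integral {F : ℕ → ℝ → ℂ} {C : ℝ} (hF : ∀ n, Measurable (F n))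
    (hf : IsBoundedBorel f) (hC : ∀ n x, ‖F n x‖ ≤ C)
    (hlim : ∀ x, Tendsto (fun n => F n x) atTop (𝓝 (f x))) (φ ψ : H) :
    Tendsto (fun n => ⟪φ, E.integral (F n) ψ⟫_ℂ) atTop (𝓝 ⟪φ, E.integral f ψ⟫_ℂ) := by
  refine tendsto_inner_apply_of_tendsto_inner_apply_self (fun χ => ?_) φ ψ
  simp only [fun n => E.inner_integral_self ⟨hF n, C, hC n⟩, E.inner_integral_self hf]
  exact tendsto_integral_of_dominated_convergence (fun _ => C)
    (fun n => (hF n).aestronglyMeasurable) (integrable_const _)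
    (fun n => Eventually.of_forall (hC n)) (Eventually.of_forall hlim)

theorem integral_simpleFunc_mul (s : SimpleFunc ℝ ℂ) (hf : IsBoundedBorel f) :
    E.integral (s * f) = E.integral s * E.integral f := by
  induction s using SimpleFunc.induction with
  | @const c B hB =>
    have hcoe : (SimpleFunc.piecewise B hB (.const ℝ c) (.const ℝ 0) : ℝ → ℂ)
        = c • B.indicator fun _ => 1 := by
      ext x
      by_cases hx : x ∈ B <;> simp [hx]
    have hmul : (c • B.indicator fun _ => 1) * f = c • B.indicator f := by
      ext x
      by_cases hx : x ∈ B <;> simp [hx]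
    rw [hcoe, hmul, E.integral_smul c (hf.indicator hB),
      E.integral_smul c ((isBoundedBorel_const 1).indicator hB), E.integral_indicator_one hB,
      smul_mul_assoc, E.proj_mul_integral hf hB]
  | @add s t _ hs ht =>
    have hs' := isBoundedBorel_simpleFunc s
    have ht' := isBoundedBorel_simpleFunc t
    rw [SimpleFunc.coe_add, add_mul, E.integral_add (hs'.mul hf) (ht'.mul hf),
      E.integral_add hs' ht', hs, ht, add_mul]

theorem integral_mul (hf : IsBoundedBorel f) (hg : IsBoundedBorel g) :
    E.integral (f * g) = E.integral f * E.integral g := by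
  obtain ⟨s, C, hC, hlim⟩ := hf.exists_simpleFunc_tendsto
  obtain ⟨D, hD⟩ := hg.exists_norm_le
  refine ContinuousLinearMap.ext fun ψ => ext_inner_left ℂ fun φ => ?_
  have hmul := E.tendsto_inner_integral (F := fun n => s n * g) (C := C * D)
    (fun n => (s n).measurable.mul hg.measurable) (hf.mul hg)
    (fun n x => norm_mul_le_of_le (hC n x) (hD x)) (fun x => (hlim x).mul_const (g x)) φ ψ
  have hcomp := E.tendsto_inner_integral (F := fun n => s n) (fun n => (s n).measurable) hf hC hlim
    φ (E.integral g ψ)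
  simp only [E.integral_simpleFunc_mul _ hg] at hmul
  exact tendsto_nhds_unique hmul hcomp

theorem integral_mul_comm (hf : IsBoundedBorel f) (hg : IsBoundedBorel g) :
    E.integral f * E.integral g = E.integral g * E.integral f := by
  rw [← E.integral_mul hf hg, mul_comm f, E.integral_mul hg hf]

theorem inner_integral_integral (hf : IsBoundedBorel f) (hg : IsBoundedBorel g) (ψ : H) :
    ⟪E.integral f ψ, E.integral g ψ⟫_ℂ = ∫ x, g x * star (f x) ∂E.measure ψ := by
  rw [← ContinuousLinearMap.adjoint_inner_right, E.adjoint_integral hf, ← mul_apply_eq_comp,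
    E.integral_mul_comm hf.star hg, ← E.integral_mul hg hf.star,
    E.inner_integral_self (hg.mul hf.star)]
  rfl

theorem norm_integral_phase_apply (t : ℝ) (ψ : H) : ‖E.integral (phase t) ψ‖ = ‖ψ‖ := by
  have hsq : ((‖E.integral (phase t) ψ‖ ^ 2 : ℝ) : ℂ) = ((‖ψ‖ ^ 2 : ℝ) : ℂ) := by
    have h := E.inner_integral_integral (isBoundedBorel_phase t) (isBoundedBorel_phase t) ψ
    simp only [RCLike.star_def, RCLike.mul_conj, norm_phase] at h
    rw [inner_self_eq_norm_sq_to_K] at h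
    simpa [E.measure_real_apply, E.proj_univ] using h
  exact (sq_eq_sq₀ (norm_nonneg _) (norm_nonneg _)).1 (Complex.ofReal_injective hsq)

end ProjValuedMeasure

end FunctionalCalculus

/-! ### Totally bounded orbits -/

section TotallyBounded

variable {𝕜 V : Type*} [RCLike 𝕜] [NormedAddCommGroup V] [InnerProductSpace 𝕜 V]

theorem norm_sq_div_two_le_norm_inner {x y : V} (h : ‖x - y‖ ≤ ‖x‖ / 2) :
    ‖x‖ ^ 2 / 2 ≤ ‖⟪y, x⟫_𝕜‖ := by
  have hinner : ‖x‖ ^ 2 ≤ ‖x‖ / 2 * ‖x‖ + ‖⟪y, x⟫_𝕜‖ :=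
    calc ‖x‖ ^ 2 = ‖⟪x - y, x⟫_𝕜 + ⟪y, x⟫_𝕜‖ := by
          rw [← inner_add_left, sub_add_cancel, inner_self_eq_norm_sq_to_K]
          simp
      _ ≤ ‖x - y‖ * ‖x‖ + ‖⟪y, x⟫_𝕜‖ := norm_add_le_of_le (norm_inner_le_norm _ _) le_rfl
      _ ≤ ‖x‖ / 2 * ‖x‖ + ‖⟪y, x⟫_𝕜‖ := by gcongr
  linarith

/-- Correlations that vanish in the Cesàro mean are incompatible with a finite `r / 2`-net. -/
theorem eq_zero_of_totallyBounded_of_tendsto_cesaro {u : ℕ → V} {r : ℝ} (hr : ∀ n, ‖u n‖ = r)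
    (hu : TotallyBounded (Set.range u))
    (hlim : ∀ k, Tendsto (fun N : ℕ => (N : ℝ)⁻¹ * ∑ n ∈ Finset.range N, ‖⟪u k, u n⟫_𝕜‖ ^ 2)
      atTop (𝓝 0)) : r = 0 := by
  by_contra hr0
  have hr_pos : 0 < r := lt_of_le_of_ne (hr 0 ▸ norm_nonneg _) (Ne.symm hr0)
  obtain ⟨t, htu, htfin, hcover⟩ :=
    Metric.finite_approx_of_totallyBounded hu (r / 2) (by positivity)
  lift t to Finset V using htfin
  have hlower (n : ℕ) : (r ^ 2 / 2) ^ 2 ≤ ∑ φ ∈ t, ‖⟪φ, u n⟫_𝕜‖ ^ 2 := by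
    obtain ⟨φ, hφ, hdist⟩ := Set.mem_iUnion₂.1 (hcover (Set.mem_range_self n))
    have hclose : ‖u n - φ‖ ≤ ‖u n‖ / 2 := by
      rw [hr, ← dist_eq_norm]
      exact (Metric.mem_ball.1 hdist).le
    calc (r ^ 2 / 2) ^ 2 ≤ ‖⟪φ, u n⟫_𝕜‖ ^ 2 := by
          gcongr
          simpa [hr] using norm_sq_div_two_le_norm_inner (𝕜 := 𝕜) hclose
      _ ≤ ∑ φ ∈ t, ‖⟪φ, u n⟫_𝕜‖ ^ 2 :=
          Finset.single_le_sum (f := fun φ => ‖⟪φ, u n⟫_𝕜‖ ^ 2) (fun _ _ => by positivity) hφ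
  have hsum : Tendsto (fun N : ℕ => ∑ φ ∈ t, (N : ℝ)⁻¹ * ∑ n ∈ Finset.range N, ‖⟪φ, u n⟫_𝕜‖ ^ 2)
      atTop (𝓝 0) := by
    rw [← Finset.sum_const_zero (s := t)]
    refine tendsto_finsetSum t fun φ hφ => ?_
    obtain ⟨k, rfl⟩ := htu hφ
    exact hlim k
  have hle : (r ^ 2 / 2) ^ 2 ≤ 0 := by
    refine ge_of_tendsto hsum ((eventually_gt_atTop 0).mono fun N hN => ?_)
    calc (r ^ 2 / 2) ^ 2 = (N : ℝ)⁻¹ * ∑ n ∈ Finset.range N, (r ^ 2 / 2) ^ 2 := by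
          rw [Finset.sum_const, Finset.card_range, nsmul_eq_mul, inv_mul_cancel_left₀]
          exact_mod_cast hN.ne'
      _ ≤ (N : ℝ)⁻¹ * ∑ n ∈ Finset.range N, ∑ φ ∈ t, ‖⟪φ, u n⟫_𝕜‖ ^ 2 := by
          gcongr with n
          exact hlower n
      _ = ∑ φ ∈ t, (N : ℝ)⁻¹ * ∑ n ∈ Finset.range N, ‖⟪φ, u n⟫_𝕜‖ ^ 2 := by
          rw [Finset.sum_comm, Finset.mul_sum]
  exact hle.not_gt (by positivity)

theorem totallyBounded_setOf_norm_inner_le [CompleteSpace V] {ι : Type*}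
    (b : HilbertBasis ι 𝕜 V) {a : ι → ℝ} (ha : Summable a) :
    TotallyBounded {x : V | ∀ i, ‖⟪b i, x⟫_𝕜‖ ≤ a i} := by
  let K : Set (ι → 𝕜) := Set.univ.pi fun i => Metric.closedBall 0 (a i)
  have hK_compact : IsCompact K := isCompact_univ_pi fun i => isCompact_closedBall 0 (a i)
  have hcont : ContinuousOn (fun c : ι → 𝕜 => ∑' i, c i • b i) K := by
    refine continuousOn_tsum (fun i => by fun_prop) ha fun i c hc => ?_
    rw [norm_smul, b.orthonormal.norm_eq_one, mul_one]
    simpa using hc i (Set.mem_univ i)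
  refine (hK_compact.image_of_continuousOn hcont).totallyBounded.subset fun x hx => ?_
  refine ⟨fun i => ⟪b i, x⟫_𝕜, fun i _ => by simpa using hx i, ?_⟩
  simpa only [b.repr_apply_apply] using (b.hasSum_repr x).tsum_eq

end TotallyBounded

section FunctionalCalculus

variable {H : Type*} [NormedAddCommGroup H] [InnerProductSpace ℂ H] [CompleteSpace H]

namespace ProjValuedMeasure

variable (E : ProjValuedMeasure H) {f : ℝ → ℂ} {χ : H}

theorem tendsto_cesaro_norm_sq_inner_integral_phase [NullSingletonClass (E.measure χ)]
    (hf : IsBoundedBorel f) :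
    Tendsto (fun N : ℕ => (N : ℝ)⁻¹ *
      ∑ n ∈ Finset.range N, ‖⟪E.integral f χ, E.integral (phase n) χ⟫_ℂ‖ ^ 2) atTop (𝓝 0) := by
  simp only [E.inner_integral_integral hf (isBoundedBorel_phase _)]
  exact tendsto_cesaro_norm_sq_integral_phase_mul (hf.star.integrable _)

theorem eq_zero_of_totallyBounded_orbit [NullSingletonClass (E.measure χ)]
    (h : TotallyBounded (Set.range fun n : ℕ => E.integral (phase n) χ)) : χ = 0 :=
  norm_eq_zero.1 <| eq_zero_of_totallyBounded_of_tendsto_cesaro (𝕜 := ℂ)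
    (fun _ => E.norm_integral_phase_apply _ χ) h
    fun _ => E.tendsto_cesaro_norm_sq_inner_integral_phase (isBoundedBorel_phase _)

end ProjValuedMeasure

end FunctionalCalculus

/-! ### Atoms of the spectral measure and eigenvectors -/

section Atoms

variable {α : Type*} [MeasurableSpace α] [MeasurableSingletonClass α] (μ : Measure α)

theorem countable_setOf_measure_singleton_pos [SFinite μ] : {x | 0 < μ {x}}.Countable :=
  Measure.countable_meas_pos_of_disjoint_iUnion measurableSet_singleton
    fun _ _ hxy => Set.disjoint_singleton.2 hxy

theorem nullSingletonClass_restrict_compl_atoms :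
    NullSingletonClass (μ.restrict {x | 0 < μ {x}}ᶜ) := by
  refine ⟨fun x => ?_⟩
  rw [Measure.restrict_apply (measurableSet_singleton x)]
  by_cases hx : 0 < μ {x}
  · simp [hx]
  · exact measure_mono_null Set.inter_subset_left (le_zero_iff.1 (not_lt.1 hx))

end Atoms

section Eigenvectors

variable {H : Type*} [NormedAddCommGroup H] [InnerProductSpace ℂ H]

theorem inner_apply_eq_zero_of_inner_apply_self_add {p : Submodule ℂ H} {L : p →ₗ[ℂ] H} {η : p}
    (h : ∀ (ζ : p) (c : ℂ), ⟪((ζ + c • η : p) : H), L (ζ + c • η)⟫_ℂ = ⟪(ζ : H), L ζ⟫_ℂ) (ζ : p) :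
    ⟪(ζ : H), L η⟫_ℂ = 0 := by
  have hself : ⟪(η : H), L η⟫_ℂ = 0 := by simpa using h 0 1
  have hcross (c : ℂ) : c * ⟪(ζ : H), L η⟫_ℂ + (starRingEnd ℂ) c * ⟪(η : H), L ζ⟫_ℂ = 0 := by
    have hc := h ζ c
    simp only [Submodule.coe_add, Submodule.coe_smul, map_add, map_smul, inner_add_left,
      inner_add_right, inner_smul_left, inner_smul_right, hself, mul_zero, add_zero] at hc
    linear_combination hc
  have h1 := hcross 1
  have hI := hcross Complex.I
  simp only [map_one, Complex.conj_I] at h1 hI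
  linear_combination h1 / 2 - Complex.I / 2 * hI +
    (⟪(ζ : H), L η⟫_ℂ - ⟪(η : H), L ζ⟫_ℂ) / 2 * Complex.I_mul_I

variable [CompleteSpace H]

theorem contProj_apply_eq_zero_iff {T : H →ₗ.[ℂ] H} {ψ : H} :
    contProj T ψ = 0 ↔ ∀ χ ∈ (pointSubspace T)ᗮ, ⟪χ, ψ⟫_ℂ = 0 := by
  rw [contProj, Submodule.starProjection_apply_eq_zero_iff, Submodule.mem_orthogonal]

namespace IsSpectralMeasure

variable {E : ProjValuedMeasure H} {T : H →ₗ.[ℂ] H} {D : Set ℝ} {ψ χ : H}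

theorem proj_singleton_mem_domain (hE : IsSpectralMeasure E T) (x : ℝ) (ψ : H) :
    E.proj {x} ψ ∈ T.domain := by
  rw [hE.mem_domain_iff, E.measure_proj (measurableSet_singleton x)]
  exact integrableOn_singleton (by simp) (measure_lt_top _ _)

theorem integrable_id (hE : IsSpectralMeasure E T) (ζ : T.domain) :
    Integrable (fun y : ℝ => y) (E.measure (ζ : H)) :=
  ((memLp_two_iff_integrable_sq measurable_id.aestronglyMeasurable).2
    ((hE.mem_domain_iff ζ).1 ζ.2)).integrable one_le_two

theorem inner_apply_sub_smul (hE : IsSpectralMeasure E T) (x : ℝ) (ζ : T.domain) :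
    ⟪(ζ : H), T ζ - (x : ℂ) • (ζ : H)⟫_ℂ
      = ((∫ y, (y - x) ∂E.measure (E.proj {x}ᶜ (ζ : H)) : ℝ) : ℂ) := by
  rw [E.measure_proj (measurableSet_singleton x).compl,
    setIntegral_eq_integral_of_forall_compl_eq_zero fun y hy => sub_eq_zero.2 (by simpa using hy),
    integral_sub (hE.integrable_id ζ) (integrable_const _), inner_sub_right,
    hE.inner_apply, inner_smul_right, inner_self_eq_norm_sq_to_K, integral_const,
    E.measure_real_apply _ MeasurableSet.univ, E.proj_univ]
  simp [mul_comm]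

theorem apply_proj_singleton (hE : IsSpectralMeasure E T) (hT : Dense (T.domain : Set H)) (x : ℝ)
    (ψ : H) : T ⟨E.proj {x} ψ, hE.proj_singleton_mem_domain x ψ⟩ = (x : ℂ) • E.proj {x} ψ := by
  set η : T.domain := ⟨E.proj {x} ψ, hE.proj_singleton_mem_domain x ψ⟩
  have hcompl : E.proj {x}ᶜ (η : H) = 0 := by
    rw [E.proj_proj_apply (measurableSet_singleton x).compl (measurableSet_singleton x),
      Set.compl_inter_self, E.proj_empty, zero_apply]
  have horth (ζ : T.domain) : ⟪(ζ : H), T η - (x : ℂ) • (η : H)⟫_ℂ = 0 := by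
    refine inner_apply_eq_zero_of_inner_apply_self_add
      (L := T.toFun - (x : ℂ) • T.domain.subtype) (fun ζ c => ?_) ζ
    have hquad (ξ : T.domain) := hE.inner_apply_sub_smul x ξ
    refine (hquad _).trans (Eq.trans ?_ (hquad _).symm)
    rw [Submodule.coe_add, Submodule.coe_smul, map_add, map_smul, hcompl, smul_zero, add_zero]
  exact sub_eq_zero.1 (hT.eq_zero_of_inner_right (𝕜 := ℂ) fun ζ hζ => horth ⟨ζ, hζ⟩)

theorem proj_singleton_mem_pointSubspace (hE : IsSpectralMeasure E T)
    (hT : Dense (T.domain : Set H)) (x : ℝ) (ψ : H) : E.proj {x} ψ ∈ pointSubspace T :=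
  Submodule.le_topologicalClosure _
    (Submodule.subset_span ⟨_, x, hE.apply_proj_singleton hT x ψ⟩)

theorem proj_singleton_apply_eq_zero (hE : IsSpectralMeasure E T)
    (hT : Dense (T.domain : Set H)) (hχ : χ ∈ (pointSubspace T)ᗮ) (x : ℝ) :
    E.proj {x} χ = 0 := by
  have h := hχ _ (hE.proj_singleton_mem_pointSubspace hT x χ)
  rw [E.inner_proj_left (measurableSet_singleton x),
    E.inner_proj_self (measurableSet_singleton x)] at h
  simpa using h

theorem contProj_proj_of_countable (hE : IsSpectralMeasure E T) (hT : Dense (T.domain : Set H))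
    (hD : D.Countable) (ψ : H) : contProj T (E.proj D ψ) = 0 := by
  refine contProj_apply_eq_zero_iff.2 fun χ hχ => ?_
  have hnull : E.measure χ D = 0 :=
    (measure_null_iff_singleton hD).2 fun x _ =>
      (E.measure_eq_zero_iff (measurableSet_singleton x) χ).2
        (hE.proj_singleton_apply_eq_zero hT hχ x)
  rw [← E.inner_proj_left hD.measurableSet, (E.measure_eq_zero_iff hD.measurableSet χ).1 hnull,
    inner_zero_left]

/-- One direction of the RAGE (Ruelle–Amrein–Georgescu–Enss) theorem. -/
theorem contProj_eq_zero_of_totallyBounded_orbit (hE : IsSpectralMeasure E T)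
    (hT : Dense (T.domain : Set H))
    (hψ : TotallyBounded (Set.range fun n : ℕ => E.integral (phase n) ψ)) : contProj T ψ = 0 := by
  set D : Set ℝ := {x | 0 < E.measure ψ {x}}
  have hD : D.Countable := countable_setOf_measure_singleton_pos _
  have hDc : MeasurableSet Dᶜ := hD.measurableSet.compl
  have hatomless : NullSingletonClass (E.measure (E.proj Dᶜ ψ)) := by
    rw [E.measure_proj hDc]
    exact nullSingletonClass_restrict_compl_atoms _
  have hcomm (t : ℝ) : E.integral (phase t) (E.proj Dᶜ ψ) = E.proj Dᶜ (E.integral (phase t) ψ) := by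
    rw [← E.integral_indicator_one hDc, ← mul_apply_eq_comp, ← mul_apply_eq_comp,
      E.integral_mul_comm (isBoundedBorel_phase t) ((isBoundedBorel_const 1).indicator hDc)]
  have horbit : TotallyBounded (Set.range fun n : ℕ => E.integral (phase n) (E.proj Dᶜ ψ)) := by
    simp only [hcomm]
    rw [Set.range_comp' (E.proj Dᶜ)]
    exact hψ.image (E.proj Dᶜ).uniformContinuous
  have hψD : E.proj D ψ = ψ := by
    simpa [E.eq_zero_of_totallyBounded_orbit horbit] using
      congrArg (fun A : H →L[ℂ] H => A ψ) (E.proj_add_proj_compl hD.measurableSet)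
  rw [← hψD]
  exact hE.contProj_proj_of_countable hT hD ψ

end IsSpectralMeasure

end Eigenvectors

/-! ### Dynamical localization -/

section Localization

variable {H : Type*} [NormedAddCommGroup H] [InnerProductSpace ℂ H] [CompleteSpace H]
  {T : H →ₗ.[ℂ] H} {I : Set ℝ}

/-- The amplitude `sup_t |⟨φ, e^{-itT} χ_I(T) ψ⟩|`, whose expectation is bounded in
`DynamicallyLocalized`. -/
def maxAmplitude (T : H →ₗ.[ℂ] H) (I : Set ℝ) (φ ψ : H) : ℝ :=
  ⨆ t : ℝ, ‖⟪φ, evolution T t (spectralProj T I ψ)⟫_ℂ‖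

theorem maxAmplitude_nonneg (T : H →ₗ.[ℂ] H) (I : Set ℝ) (φ ψ : H) : 0 ≤ maxAmplitude T I φ ψ :=
  Real.iSup_nonneg fun _ => norm_nonneg _

theorem exists_borelCalc_eq_integral (hT : ∃ E : ProjValuedMeasure H, IsSpectralMeasure E T) :
    ∃ E : ProjValuedMeasure H, IsSpectralMeasure E T ∧ borelCalc T = E.integral :=
  ⟨hT.choose, hT.choose_spec, funext fun _ => dif_pos hT⟩

theorem norm_inner_integral_phase_le_maxAmplitude {E : ProjValuedMeasure H}
    (hcalc : borelCalc T = E.integral) (φ ψ : H) (t : ℝ) :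
    ‖⟪φ, E.integral (phase t) (spectralProj T I ψ)⟫_ℂ‖ ≤ maxAmplitude T I φ ψ := by
  have hevol (s : ℝ) : evolution T s = E.integral (phase s) := congrFun hcalc _
  simp only [maxAmplitude, hevol]
  refine le_ciSup (f := fun s => ‖⟪φ, E.integral (phase s) (spectralProj T I ψ)⟫_ℂ‖)
    ⟨‖φ‖ * ‖spectralProj T I ψ‖, ?_⟩ t
  rintro _ ⟨s, rfl⟩
  exact (norm_inner_le_norm _ _).trans_eq (by rw [E.norm_integral_phase_apply])

theorem hasPurePointSpectrumIn_of_summable_maxAmplitude {ι : Type*} (b : HilbertBasis ι ℂ H)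
    (hT : Dense (T.domain : Set H))
    (hsum : ∀ k, Summable fun j => maxAmplitude T I (b j) (b k)) : HasPurePointSpectrumIn T I := by
  by_cases hex : ∃ E : ProjValuedMeasure H, IsSpectralMeasure E T
  · obtain ⟨E, hE, hcalc⟩ := exists_borelCalc_eq_integral hex
    refine ContinuousLinearMap.ext_on (s := Set.range b)
      (Submodule.dense_iff_topologicalClosure_eq_top.2 b.dense_span) ?_
    rintro _ ⟨k, rfl⟩
    refine hE.contProj_eq_zero_of_totallyBounded_orbit hT
      ((totallyBounded_setOf_norm_inner_le b (hsum k)).subset ?_)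
    rintro _ ⟨n, rfl⟩ j
    exact norm_inner_integral_phase_le_maxAmplitude hcalc _ _ _
  · -- Without a spectral measure `borelCalc T` takes the junk value `0`.
    rw [HasPurePointSpectrumIn, spectralProj, borelCalc, dif_neg hex, ContinuousLinearMap.comp_zero]

end Localization

section Summability

theorem summable_exp_neg_mul_abs {m : ℝ} (hm : 0 < m) :
    Summable fun n : ℤ => Real.exp (-m * |(n : ℝ)|) := by
  have h : Summable fun n : ℕ => Real.exp (-m * n) := by
    simpa [mul_comm] using Real.summable_exp_nat_mul_iff.2 (neg_lt_zero.2 hm)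
  refine Summable.of_nat_of_neg ?_ ?_ <;> simpa using h

theorem summable_exp_neg_mul_graphNorm {m : ℝ} (hm : 0 < m) :
    ∀ d : ℕ, Summable fun n : Lattice d => Real.exp (-m * graphNorm n)
  | 0 => (hasSum_fintype _).summable
  | d + 1 => by
    rw [← (Fin.consEquiv fun _ : Fin (d + 1) => ℤ).summable_iff]
    refine ((summable_exp_neg_mul_abs hm).mul_of_nonneg (summable_exp_neg_mul_graphNorm hm d)
      (fun _ => (Real.exp_pos _).le) (fun _ => (Real.exp_pos _).le)).congr fun p => ?_
    simp only [Function.comp_apply, Fin.consEquiv_apply, graphNorm, Fin.sum_univ_succ,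
      Fin.cons_zero, Fin.cons_succ]
    rw [← Real.exp_add]
    push_cast
    ring_nf

theorem ae_summable_of_summable_integral {Ω ι : Type*} [MeasurableSpace Ω] [Countable ι]
    {P : Measure Ω} {X : ι → Ω → ℝ} (hX : ∀ i, Integrable (X i) P) (hX0 : ∀ i ω, 0 ≤ X i ω)
    (hsum : Summable fun i => ∫ ω, X i ω ∂P) : ∀ᵐ ω ∂P, Summable fun i => X i ω := by
  have hnorm (i : ι) : eLpNorm (X i) 1 P = ENNReal.ofReal (∫ ω, X i ω ∂P) := by
    rw [eLpNorm_one_eq_lintegral_enorm, ← ofReal_integral_norm_eq_lintegral_enorm (hX i)]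
    simp only [Real.norm_of_nonneg (hX0 i _)]
  have hfin : ∑' i, eLpNorm (X i) 1 P ≠ ⊤ := by
    simpa only [hnorm] using hsum.tsum_ofReal_ne_top
  exact (summable_norm_of_tsum_eLpNorm_ne_top le_rfl
    (fun i => (hX i).aestronglyMeasurable) hfin).mono fun _ hω => hω.of_norm

end Summability

section AndersonModel

variable {d : ℕ}

/-- The vectors `basisVec j` as a Hilbert basis of `ℓ²(ℤ^d)`; see `standardBasis_apply`. -/
def standardBasis (d : ℕ) : HilbertBasis (Lattice d) ℂ (L2 d) :=
  .ofRepr (.refl ℂ (L2 d))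

theorem standardBasis_apply (j : Lattice d) : standardBasis d j = basisVec j := by
  rw [← HilbertBasis.repr_symm_single]
  change (lp.single (E := fun _ : Lattice d => ℂ) 2 j 1 : L2 d) = lp.single 2 j 1
  congr

theorem basisVec_mem_domain (v : Lattice d → ℝ) (j : Lattice d) :
    basisVec j ∈ (hamiltonian v).domain := by
  change Memℓp (fun n => (v n : ℂ) * (basisVec j : L2 d) n) 2
  have h : (fun n => (v n : ℂ) * (basisVec j : L2 d) n)
      = ((v j : ℂ) • (basisVec j : L2 d) : L2 d) := by
    ext n
    rw [lp.coeFn_smul, Pi.smul_apply, smul_eq_mul]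
    by_cases hn : n = j
    · rw [hn]
    · simp [basisVec, lp.single_apply, Pi.single_eq_of_ne hn]
  rw [h]
  exact lp.memℓp _

theorem dense_domain_hamiltonian (v : Lattice d → ℝ) :
    Dense ((hamiltonian v).domain : Set (L2 d)) := by
  refine (Submodule.dense_iff_topologicalClosure_eq_top.2 (standardBasis d).dense_span).mono ?_
  refine Submodule.span_le.2 ?_
  rintro _ ⟨j, rfl⟩
  rw [standardBasis_apply]
  exact basisVec_mem_domain v j

namespace DynamicallyLocalized

variable {Ω : Type*} [MeasurableSpace Ω] {P : Measure Ω} {V : Lattice d → Ω → ℝ} {I : Set ℝ}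

theorem integrable_maxAmplitude (h : DynamicallyLocalized P V I) (j k : Lattice d) :
    Integrable (fun ω => maxAmplitude (hamiltonian fun n => V n ω) I (basisVec j) (basisVec k))
      P := by
  obtain ⟨_, _, _, hX⟩ := h
  exact (hX j k).1

theorem summable_integral_maxAmplitude (h : DynamicallyLocalized P V I) (k : Lattice d) :
    Summable fun j =>
      ∫ ω, maxAmplitude (hamiltonian fun n => V n ω) I (basisVec j) (basisVec k) ∂P := by
  obtain ⟨C, m, hm, hX⟩ := h
  exact Summable.of_nonneg_of_le (fun j => integral_nonneg fun ω => maxAmplitude_nonneg ..)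
    (fun j => (hX j k).2) <| ((summable_exp_neg_mul_graphNorm hm d).comp_injective
      (sub_left_injective (b := k))).mul_left C

end DynamicallyLocalized

end AndersonModel

end Anderson

end

open Anderson in
theorem proposition5p3_general {Ω : Type*} [MeasurableSpace Ω] {P : Measure Ω}
    {d : ℕ} {V : Lattice d → Ω → ℝ} {I : Set ℝ}
    (hint : ∀ j k, Integrable
      (fun ω => maxAmplitude (hamiltonian fun n => V n ω) I (basisVec j) (basisVec k)) P)
    (hsum : ∀ k, Summable fun j =>
      ∫ ω, maxAmplitude (hamiltonian fun n => V n ω) I (basisVec j) (basisVec k) ∂P) :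
    ∀ᵐ ω ∂P, HasPurePointSpectrumIn (hamiltonian fun n => V n ω) I := by
  have hae (k : Lattice d) : ∀ᵐ ω ∂P, Summable fun j =>
      maxAmplitude (hamiltonian fun n => V n ω) I (basisVec j) (basisVec k) :=
    ae_summable_of_summable_integral (hint · k) (fun _ _ => maxAmplitude_nonneg ..) (hsum k)
  filter_upwards [ae_all_iff.2 hae] with ω hω
  refine hasPurePointSpectrumIn_of_summable_maxAmplitude (standardBasis d)
    (dense_domain_hamiltonian _) ?_
  simpa only [standardBasis_apply] using hω

theorem proposition5p3 {Ω : Type*} [MeasurableSpace Ω] (P : MeasureTheory.Measure Ω)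
    [MeasureTheory.IsProbabilityMeasure P] (d : ℕ) (hd : 1 ≤ d)
    (μ : MeasureTheory.Measure ℝ) (V : Anderson.Lattice d → Ω → ℝ)
    (hV : Anderson.IsIIDPotential P μ V)
    (I : Set ℝ) (hI : IsOpen I) (hI' : I.OrdConnected)
    (hloc : Anderson.DynamicallyLocalized P V I) :
    ∀ᵐ ω ∂P, Anderson.HasPurePointSpectrumIn (Anderson.hamiltonian fun n => V n ω) I :=
  proposition5p3_general hloc.integrable_maxAmplitude hloc.summable_integral_maxAmplitude
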